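/- Let $\phi_1,\phi_2:\mathbb R^3\to\mathbb R$ be twice continuously differentiable, let $k_1,k_2>0$, and put $n_i=\nabla\phi_i$, $\tau=n_1\times n_2$, $N=(n_1,n_2)\in\mathbb R^{3\times 2}$, $K=\mathrm{diag}(k_1,k_2)$, $e=(\phi_1,\phi_2)^{T}$ and $\chi=\tau-NKe$. Let $$\mathcal P=\{\xi: e(\xi)=0\},\quad \mathcal M=\{\xi: N(\xi)Ke(\xi)=0\},\quad \mathcal C=\{\xi:\chi(\xi)=0\},\quad \mathcal C'=\{\xi\in\mathbb R^3\setminus\mathcal M:\tau(\xi)=0\}.$$ All norms are Euclidean, $\mathrm{dist}(\mathcal A,\mathcal B)=\inf\{\|a-b\|:a\in\mathcal A,\,b\in\mathcal B\}$, and $\inf\emptyset=+\infty$. Assume that $\mathcal P$ is nonempty and bounded, that $\mathrm{dist}(\mathcal P,\mathcal C)>0$, that $\inf\{\|e(\xi)\|:\mathrm{dist}(\xi,\mathcal P)\ge\kappa\}>0$ for every $\kappa>0$, and that $\mathrm{dist}(\mathcal P,\mathcal C')>0$. A disturbance is a bounded, piecewise continuous function $d:[0,\infty)\to\mathbb R^3$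 (finitely many discontinuities on each bounded interval, with one-sided limits). Consider the perturbed system $$\dot\xi(t)=\chi(\xi(t))+d(t),$$ whose solutions are continuous and satisfy the equation at every time at which $d$ is continuous. Along each of its solutions on an interval $[0,T)$, the path-following error $e(t)=e(\xi(t))$ satisfies, in the same sense, the error dynamics $$\dot e(t)=N(\xi(t))^{T}\big(\chi(\xi(t))+d(t)\big).$$ These error dynamics are locally input-to-state stable: there are a function $\beta:[0,\infty)^2\to[0,\infty)$ of class $\mathcal{KL}$, a function $\gamma:[0,\infty)\to[0,\infty)$ of class $\mathcal K$ and constants $c,r>0$, depending only on $\phi_1,\phi_2,k_1,k_2$, such that for every $\xi_0\in\mathbb R^3$ with $\|e(\xi_0)\|<c$ and every disturbance $d$ with $\sup_{s\ge0}\|d(s)\|<r$, the perturbed system has a solution on $[0,\infty)$ with $\xi(0)=\xi_0$, and every solution with $\xi(0)=\xi_0$ on any interval $[0,T)$, $0<T\le\infty$, satisfies $$\|e(\xi(t))\|\le\beta\big(\|e(\xi_0)\|,t\big)+\gamma\Big(\sup_{0\le s\le t}\|d(s)\|\Big)\qquad\text{for all }t\in[0,T).$$ Here $\gamma$ is of class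 $\mathcal K$ if it is continuous and strictly increasing with $\gamma(0)=0$; $\beta$ is of class $\mathcal{KL}$ if it is continuous, $\beta(\cdot,s)$ is of class $\mathcal K$ for each $s\ge0$, and $\beta(\rho,\cdot)$ is nonincreasing with limit $0$ at infinity for each $\rho\ge0$. -/

import Mathlib

noncomputable section

namespace PathFollowing

/-- Points of three-dimensional Euclidean space. -/
abbrev E3 : Type := EuclideanSpace ℝ (Fin 3)

/-- Points of the Euclidean plane, in which the path-following error takes its values. -/
abbrev E2 : Type := EuclideanSpace ℝ (Fin 2)

/-- The distance `inf {‖a - b‖ : a ∈ A, b ∈ B}` between two sets, with `inf ∅ = ∞`. -/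
def setDist (A B : Set E3) : ENNReal :=
  ⨅ a ∈ A, ⨅ b ∈ B, edist a b

/-- The desired path `P`, the common zero set of the two functions `φ 0` and `φ 1`. -/
def desiredPath (φ : Fin 2 → E3 → ℝ) : Set E3 :=
  {ξ | ∀ i, φ i ξ = 0}

/-- The path-following error vector `e(ξ) = (φ₁(ξ), φ₂(ξ))`. -/
def error (φ : Fin 2 → E3 → ℝ) (ξ : E3) : E2 :=
  WithLp.toLp 2 (fun i => φ i ξ)

/-- The `3 × 2` matrix `N(ξ)` whose columns are the gradients `n_i(ξ) = ∇ φ_i(ξ)`. -/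
def normalMatrix (φ : Fin 2 → E3 → ℝ) (ξ : E3) : Matrix (Fin 3) (Fin 2) ℝ :=
  Matrix.of (fun i j => gradient (φ j) ξ i)

/-- The tangential term `τ(ξ) = n₁(ξ) × n₂(ξ)`. -/
def tangent (φ : Fin 2 → E3 → ℝ) (ξ : E3) : E3 :=
  WithLp.toLp 2 (crossProduct (gradient (φ 0) ξ).ofLp (gradient (φ 1) ξ).ofLp)

/-- The vector `N(ξ) K e(ξ)` with `K = diag(k₁, k₂)`. -/
def normalTerm (φ : Fin 2 → E3 → ℝ) (k : Fin 2 → ℝ) (ξ : E3) : E3 :=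
  WithLp.toLp 2
    (Matrix.mulVec (normalMatrix φ ξ) (Matrix.mulVec (Matrix.diagonal k) (error φ ξ).ofLp))

/-- The guiding vector field `χ(ξ) = τ(ξ) - N(ξ) K e(ξ)`. -/
def vectorField (φ : Fin 2 → E3 → ℝ) (k : Fin 2 → ℝ) (ξ : E3) : E3 :=
  tangent φ ξ - normalTerm φ k ξ

/-- The invariant set `M = {ξ : N(ξ) K e(ξ) = 0}`. -/
def invariantSet (φ : Fin 2 → E3 → ℝ) (k : Fin 2 → ℝ) : Set E3 :=
  {ξ | normalTerm φ k ξ = 0}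

/-- The singular set `C = {ξ : χ(ξ) = 0}`. -/
def singularSet (φ : Fin 2 → E3 → ℝ) (k : Fin 2 → ℝ) : Set E3 :=
  {ξ | vectorField φ k ξ = 0}

/-- The set `C' = {ξ ∉ M : τ(ξ) = 0}`. -/
def degenerateSet (φ : Fin 2 → E3 → ℝ) (k : Fin 2 → ℝ) : Set E3 :=
  {ξ | ξ ∉ invariantSet φ k ∧ tangent φ ξ = 0}

/-- For every `κ > 0` one has `inf {‖e(ξ)‖ : dist(ξ, P) ≥ κ} > 0`. -/
def ErrorControlsDistance (φ : Fin 2 → E3 → ℝ) : Prop :=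
  ∀ κ : ℝ, 0 < κ →
    0 < ⨅ ξ ∈ {ξ : E3 | κ ≤ Metric.infDist ξ (desiredPath φ)}, ENNReal.ofReal ‖error φ ξ‖

/-- Piecewise continuity on `[0, ∞)`: on every bounded interval `[0, T]` there are only finitely
many points of discontinuity, and the one-sided limits exist everywhere. -/
def PiecewiseContinuous (d : ℝ → E3) : Prop :=
  (∀ T : ℝ, {t : ℝ | t ∈ Set.Icc 0 T ∧ ¬ ContinuousWithinAt d (Set.Ici 0) t}.Finite) ∧
  (∀ t : ℝ, 0 ≤ t → ∃ l : E3, Filter.Tendsto d (nhdsWithin t (Set.Ioi t)) (nhds l)) ∧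
  (∀ t : ℝ, 0 < t → ∃ l : E3, Filter.Tendsto d (nhdsWithin t (Set.Iio t)) (nhds l))

/-- Admissible disturbances: piecewise continuous and bounded functions of `t ≥ 0`. -/
def IsDisturbance (d : ℝ → E3) : Prop :=
  PiecewiseContinuous d ∧ BddAbove ((fun s => ‖d s‖) '' Set.Ici 0)

/-- `ξ` solves `ξ' = χ(ξ) + d(t)` on the time interval `J ⊆ [0, ∞)`: it is continuous on `J`
and satisfies the equation at every time of `J` at which `d` is continuous. -/
def IsPerturbedSolution (φ : Fin 2 → E3 → ℝ) (k : Fin 2 → ℝ) (d : ℝ → E3) (J : Set ℝ)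
    (ξ : ℝ → E3) : Prop :=
  ContinuousOn ξ J ∧
    ∀ t ∈ J, ContinuousWithinAt d (Set.Ici 0) t →
      HasDerivWithinAt ξ (vectorField φ k (ξ t) + d t) J t

/-- `ε` solves `ε' = N(ξ(t))ᵀ (χ(ξ(t)) + d(t))` on the time interval `J ⊆ [0, ∞)`, in the same
sense. -/
def SolvesErrorDynamics (φ : Fin 2 → E3 → ℝ) (k : Fin 2 → ℝ) (d : ℝ → E3) (J : Set ℝ)
    (ξ : ℝ → E3) (ε : ℝ → E2) : Prop :=
  ContinuousOn ε J ∧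
    ∀ t ∈ J, ContinuousWithinAt d (Set.Ici 0) t →
      HasDerivWithinAt ε
        (WithLp.toLp 2 (Matrix.mulVec (Matrix.transpose (normalMatrix φ (ξ t)))
          (vectorField φ k (ξ t) + d t).ofLp)) J t

/-- Class `K` functions on `[0, ∞)`: continuous, strictly increasing, zero at zero. -/
def IsClassK (γ : ℝ → ℝ) : Prop :=
  ContinuousOn γ (Set.Ici 0) ∧ StrictMonoOn γ (Set.Ici 0) ∧ γ 0 = 0

/-- Class `KL` functions on `[0, ∞) × [0, ∞)`: continuous, of class `K` in the first argument,
and decreasing to zero in the second. -/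
def IsClassKL (β : ℝ → ℝ → ℝ) : Prop :=
  ContinuousOn (fun p : ℝ × ℝ => β p.1 p.2) (Set.Ici 0 ×ˢ Set.Ici 0) ∧
  (∀ s : ℝ, 0 ≤ s → IsClassK (fun r => β r s)) ∧
  (∀ r : ℝ, 0 ≤ r → AntitoneOn (β r) (Set.Ici 0) ∧
    Filter.Tendsto (β r) Filter.atTop (nhds 0))

/-- Local input-to-state stability of the path-following error. There are a class `KL` function
`β`, a class `K` function `γ` and radii `c, r > 0` such that, for every initial point `ξ₀` with
`‖e(ξ₀)‖ < c` and every admissible disturbance `d` with `sup_{s ≥ 0} ‖d(s)‖ < r`, the perturbed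
system has a solution on `[0, ∞)` starting at `ξ₀`, and every solution starting at `ξ₀`, on
whatever interval `[0, T)`, satisfies
`‖e(ξ(t))‖ ≤ β(‖e(ξ₀)‖, t) + γ(sup_{0 ≤ s ≤ t} ‖d(s)‖)`. -/
def ErrorLocallyISS (φ : Fin 2 → E3 → ℝ) (k : Fin 2 → ℝ) : Prop :=
  ∃ β : ℝ → ℝ → ℝ, ∃ γ : ℝ → ℝ, ∃ c r : ℝ,
    IsClassKL β ∧ IsClassK γ ∧ 0 < c ∧ 0 < r ∧
    ∀ (ξ₀ : E3) (d : ℝ → E3), ‖error φ ξ₀‖ < c → IsDisturbance d →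
      sSup ((fun s => ‖d s‖) '' Set.Ici 0) < r →
      (∃ ξ : ℝ → E3, IsPerturbedSolution φ k d (Set.Ici 0) ξ ∧ ξ 0 = ξ₀) ∧
      ∀ (T : ℝ) (ξ : ℝ → E3), IsPerturbedSolution φ k d (Set.Ico 0 T) ξ → ξ 0 = ξ₀ →
        ∀ t ∈ Set.Ico 0 T,
          ‖error φ (ξ t)‖ ≤
            β ‖error φ ξ₀‖ t + γ (sSup ((fun s => ‖d s‖) '' Set.Icc 0 t))

end PathFollowing

end

namespace PathFollowing

open Set Filter Topology MeasureTheory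

/-! The energy V = eᵀKe is a Lyapunov function. Put w = NKe. Since τ is orthogonal to both
gradients, V' = 2⟨w, χ + d⟩ = -2‖w‖² + 2⟨w, d⟩ ≤ -‖w‖² + ‖d‖². On the path χ = τ, so dist(P, C) > 0
forces τ ≠ 0 there; by compactness N keeps full rank, with uniform bounds, on a neighbourhood of P,
and this neighbourhood contains some set {‖e‖ < m}. There ‖w‖² ≥ aV (`exists_dissipation_bound`),
hence V' ≤ -aV + ‖d‖². For small initial error and disturbance, a sublevel set of V is never left
(`errorEnergy_trajectory`); integrating and taking square roots gives an exponential β and a linear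
γ. The sublevel set is bounded, so χ can be cut off outside a ball: the truncated field has global
solutions (`exists_solution_of_hasCompactSupport`), and they never meet the truncation. -/

/-! ### Scalar differential inequalities with exceptional times. -/

/-- A continuous function whose derivative is nonpositive off a finite set does not increase. -/
theorem image_le_of_deriv_nonpos_off_finite {f : ℝ → ℝ} (S : Finset ℝ) :
    ∀ {a b : ℝ}, a ≤ b → ContinuousOn f (Icc a b) →
      (∀ s ∈ Ioo a b, s ∉ S → ∃ f', HasDerivAt f f' s ∧ f' ≤ 0) → f b ≤ f a := by
  induction S using Finset.strongInduction with
  | H S ih =>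
    intro a b hab hf hd
    by_cases hS : ∃ c ∈ S, c ∈ Ioo a b
    · obtain ⟨c, hcS, hc⟩ := hS
      -- Cutting the interval at c makes c an endpoint, so each half has one exceptional point
      -- fewer.
      have key : ∀ {x y : ℝ}, x ≤ y → Icc x y ⊆ Icc a b → c ∉ Ioo x y → f y ≤ f x := by
        intro x y hxy hsub hcxy
        refine ih _ (Finset.erase_ssubset hcS) hxy (hf.mono hsub) fun s hs hsS => ?_
        have hsc : s ≠ c := by rintro rfl; exact hcxy hs
        have hx := hsub (left_mem_Icc.2 hxy)
        have hy := hsub (right_mem_Icc.2 hxy)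
        exact hd s ⟨hx.1.trans_lt hs.1, hs.2.trans_le hy.2⟩
          fun h => hsS (Finset.mem_erase.2 ⟨hsc, h⟩)
      exact (key hc.2.le (Icc_subset_Icc_left hc.1.le) fun h => lt_irrefl _ h.1).trans
        (key hc.1.le (Icc_subset_Icc_right hc.2.le) fun h => lt_irrefl _ h.2)
    · push Not at hS
      have hd' : ∀ s ∈ Ioo a b, ∃ f', HasDerivAt f f' s ∧ f' ≤ 0 :=
        fun s hs => hd s hs fun h => hS s h hs
      refine antitoneOn_of_deriv_nonpos (convex_Icc a b) hf ?_ ?_ (left_mem_Icc.2 hab)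
        (right_mem_Icc.2 hab) hab
      · rw [interior_Icc]
        intro s hs
        obtain ⟨f', h, -⟩ := hd' s hs
        exact h.differentiableAt.differentiableWithinAt
      · rw [interior_Icc]
        intro s hs
        obtain ⟨f', h, h'⟩ := hd' s hs
        rwa [h.deriv]

/-- Integrated form of the differential inequality `v' ≤ -a v + B`, valid off a finite set. -/
theorem le_exp_of_deriv_le_off_finite {v : ℝ → ℝ} {a B t : ℝ} (ha : 0 < a) (ht : 0 ≤ t)
    (S : Finset ℝ) (hv : ContinuousOn v (Icc 0 t))
    (hd : ∀ s ∈ Ioo 0 t, s ∉ S → ∃ v', HasDerivAt v v' s ∧ v' ≤ -a * v s + B) :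
    v t ≤ Real.exp (-a * t) * v 0 + (1 - Real.exp (-a * t)) * (B / a) := by
  have h := image_le_of_deriv_nonpos_off_finite
    (f := fun s => Real.exp (a * s) * (v s - B / a)) S ht
    (by fun_prop) (fun s hs hsS => by
      obtain ⟨v', h1, h2⟩ := hd s hs hsS
      have he : HasDerivAt (fun s => Real.exp (a * s)) (Real.exp (a * s) * a) s := by
        simpa using ((hasDerivAt_id s).const_mul a).exp
      refine ⟨_, he.mul (h1.sub_const (B / a)), ?_⟩
      have : Real.exp (a * s) * a * (v s - B / a) + Real.exp (a * s) * v'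
          = Real.exp (a * s) * (v' - (-a * v s + B)) := by
        field_simp
        ring
      rw [this]
      exact mul_nonpos_of_nonneg_of_nonpos (Real.exp_pos _).le (by linarith))
  simp only [mul_zero, Real.exp_zero, one_mul] at h
  have hexp : Real.exp (-a * t) * Real.exp (a * t) = 1 := by
    rw [← Real.exp_add]; simp
  have h' := mul_le_mul_of_nonneg_left h (Real.exp_pos (-a * t)).le
  rw [← mul_assoc, hexp, one_mul] at h'
  linarith

/-- A sublevel set on which `v' ≤ -a v + B` holds off a locally finite set cannot be left if its
level is at least `B / a`. -/
theorem lt_of_deriv_le_off_finite {v : ℝ → ℝ} {a B v₀ T : ℝ} (ha : 0 < a) (hB : B / a ≤ v₀)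
    (hv0 : v 0 < v₀) (S : ℝ → Finset ℝ) (hv : ContinuousOn v (Ico 0 T))
    (hd : ∀ t, ∀ s ∈ Ioo 0 t, t < T → s ∉ S t → v s < v₀ →
      ∃ v', HasDerivAt v v' s ∧ v' ≤ -a * v s + B) :
    ∀ t ∈ Ico 0 T, v t < v₀ := by
  intro t ht
  by_contra! hvt
  have hsub : Icc 0 t ⊆ Ico 0 T := Icc_subset_Ico_right ht.2
  -- The infimum of Z is the first time at which the level is reached.
  set Z : Set ℝ := Icc 0 t ∩ v ⁻¹' Ici v₀ with hZ
  have hZc : IsClosed Z := (hv.mono hsub).preimage_isClosed_of_isClosed isClosed_Icc isClosed_Ici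
  have hZne : Z.Nonempty := ⟨t, right_mem_Icc.2 ht.1, hvt⟩
  have hZb : BddBelow Z := ⟨0, fun s hs => hs.1.1⟩
  have hmem := hZc.csInf_mem hZne hZb
  set τ := sInf Z
  have hτT := hsub hmem.1
  have hlt : ∀ s ∈ Ioo 0 τ, v s < v₀ := by
    intro s hs
    by_contra! h
    exact absurd (csInf_le hZb ⟨⟨hs.1.le, hs.2.le.trans hmem.1.2⟩, h⟩) (not_le.2 hs.2)
  have h := le_exp_of_deriv_le_off_finite ha hmem.1.1 (S τ)
    (hv.mono (Icc_subset_Ico_right hτT.2))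
    fun s hs hsS => hd τ s hs hτT.2 hsS (hlt s hs)
  -- The bound `h` is a convex combination of v 0 < v₀ and B / a ≤ v₀ with positive weight on v 0,
  -- so v τ < v₀.
  have h1 : v₀ ≤ v τ := hmem.2
  have he : Real.exp (-a * τ) ≤ 1 := Real.exp_le_one_iff.2 (by nlinarith [hmem.1.1])
  have h2 : Real.exp (-a * τ) * v 0 < Real.exp (-a * τ) * v₀ :=
    mul_lt_mul_of_pos_left hv0 (Real.exp_pos _)
  have h3 : (1 - Real.exp (-a * τ)) * (B / a) ≤ (1 - Real.exp (-a * τ)) * v₀ :=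
    mul_le_mul_of_nonneg_left hB (by linarith)
  linarith

/-! ### Global solutions and primitives. -/

/-- A bounded, time-continuous and uniformly Lipschitz vector field has global solutions. -/
theorem exists_global_solution {E : Type*} [NormedAddCommGroup E] [NormedSpace ℝ E]
    [CompleteSpace E] {f : ℝ → E → E} {K L : NNReal} (hlip : ∀ t, LipschitzWith K (f t))
    (hcont : ∀ x, Continuous fun t => f t x) (hbd : ∀ t x, ‖f t x‖ ≤ L) (x₀ : E) :
    ∃ α : ℝ → E, α 0 = x₀ ∧ ∀ t, HasDerivAt α (f t (α t)) t := by
  have hloc : ∀ n : ℕ, ∃ α : ℝ → E, α 0 = x₀ ∧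
      ∀ t ∈ Ioo (-(n + 1 : ℝ)) (n + 1), HasDerivAt α (f t (α t)) t := by
    intro n
    have hn : (0 : ℝ) < n + 1 := by positivity
    -- At speed at most L the ball of radius L(n + 1) cannot be left within time n + 1, so no
    -- smallness of the time window is needed.
    have hpl : IsPicardLindelof f (tmin := -(n + 1 : ℝ)) (tmax := n + 1)
        ⟨0, by constructor <;> linarith⟩ x₀ (L * (n + 1)) 0 L K :=
      { lipschitzOnWith := fun t _ => (hlip t).lipschitzOnWith
        continuousOn := fun x _ => (hcont x).continuousOn
        norm_le := fun t _ x _ => hbd t x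
        mul_max_le := by simp }
    obtain ⟨α, h0, hα⟩ := hpl.exists_eq_forall_mem_Icc_hasDerivWithinAt₀
    exact ⟨α, h0, fun t ht => (hα t (Ioo_subset_Icc_self ht)).hasDerivAt (Icc_mem_nhds ht.1 ht.2)⟩
  choose α h0 hα using hloc
  have huniq : ∀ m n : ℕ, m ≤ n → EqOn (α m) (α n) (Ioo (-(m + 1 : ℝ)) (m + 1)) := by
    intro m n hmn
    have hm : (0 : ℝ) < m + 1 := by positivity
    have hmn' : (m : ℝ) ≤ n := by exact_mod_cast hmn
    refine ODE_solution_unique_of_mem_Ioo (v := f) (K := K) (s := fun _ => univ) (t₀ := 0)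
      (fun t _ => (hlip t).lipschitzOnWith) ⟨by linarith, hm⟩ (fun t ht => ⟨hα m t ht, mem_univ _⟩)
      (fun t ht => ⟨hα n t ⟨by linarith [ht.1], by linarith [ht.2]⟩, mem_univ _⟩)
      ((h0 m).trans (h0 n).symm)
  -- Window number ⌈|t|⌉₊ has radius ⌈|t|⌉₊ + 1, so t lies in its interior.
  refine ⟨fun t => α ⌈|t|⌉₊ t, h0 _, fun t => ?_⟩
  have hmem : ∀ s : ℝ, s ∈ Ioo (-(⌈|s|⌉₊ + 1 : ℝ)) (⌈|s|⌉₊ + 1) := fun s =>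
    abs_lt.1 ((Nat.le_ceil _).trans_lt (lt_add_one _))
  refine (hα ⌈|t|⌉₊ t (hmem t)).congr_of_eventuallyEq ?_
  filter_upwards [isOpen_Ioo.mem_nhds (hmem t)] with s hs
  rcases le_total ⌈|s|⌉₊ ⌈|t|⌉₊ with h | h
  · exact huniq _ _ h (hmem s)
  · exact (huniq _ _ h hs).symm

/-- A function that is bounded and continuous off a locally finite set has a continuous
primitive, differentiable wherever the function is continuous. -/
theorem exists_primitive_off_finite {E : Type*} [NormedAddCommGroup E] [NormedSpace ℝ E]
    [CompleteSpace E] [SecondCountableTopology E] {d : ℝ → E} {M : ℝ} (hM : ∀ t, ‖d t‖ ≤ M)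
    (hd : {t | ¬ ContinuousAt d t}.Countable) :
    ∃ D : ℝ → E, D 0 = 0 ∧ Continuous D ∧ ∀ t, ContinuousAt d t → HasDerivAt D (d t) t := by
  borelize E
  have hmeas : AEStronglyMeasurable d volume := by
    have h1 : AEStronglyMeasurable d (volume.restrict {t | ContinuousAt d t}) := by
      refine ContinuousOn.aestronglyMeasurable (fun t ht => ContinuousAt.continuousWithinAt ht) ?_
      have := hd.measurableSet.compl
      simpa [compl_ofPred] using this
    have h2 : volume.restrict {t | ContinuousAt d t} = (volume : Measure ℝ) := by
      refine Measure.restrict_eq_self_of_ae_mem ?_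
      rw [ae_iff]
      exact hd.measure_zero _
    rwa [h2] at h1
  have hint : ∀ a b : ℝ, IntervalIntegrable d volume a b := fun a b =>
    (intervalIntegrable_const (c := M)).mono_fun hmeas.restrict
      (Eventually.of_forall fun t => (hM t).trans (le_abs_self M))
  refine ⟨fun t => ∫ s in (0 : ℝ)..t, d s, by simp,
    intervalIntegral.continuous_primitive hint 0, fun t ht => ?_⟩
  exact intervalIntegral.integral_hasDerivAt_right (hint 0 t)
    (hmeas.stronglyMeasurableAtFilter) ht

/-! ### Algebra and regularity of the guiding field. -/

variable {φ : Fin 2 → E3 → ℝ} {k : Fin 2 → ℝ}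

theorem inner_eq_sum_three (x y : E3) : inner ℝ x y = x 0 * y 0 + x 1 * y 1 + x 2 * y 2 := by
  simp [PiLp.inner_apply, Fin.sum_univ_three, mul_comm]

theorem norm_sq_eq_sum_three (x : E3) : ‖x‖ ^ 2 = x 0 ^ 2 + x 1 ^ 2 + x 2 ^ 2 := by
  simp [EuclideanSpace.norm_sq_eq, Fin.sum_univ_three]

theorem norm_error_sq (φ : Fin 2 → E3 → ℝ) (ξ : E3) :
    ‖error φ ξ‖ ^ 2 = φ 0 ξ ^ 2 + φ 1 ξ ^ 2 := by
  simp [error, EuclideanSpace.norm_sq_eq, Fin.sum_univ_two]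

theorem normalTerm_eq (φ : Fin 2 → E3 → ℝ) (k : Fin 2 → ℝ) (ξ : E3) :
    normalTerm φ k ξ =
      (k 0 * φ 0 ξ) • gradient (φ 0) ξ + (k 1 * φ 1 ξ) • gradient (φ 1) ξ := by
  ext i
  simp [normalTerm, normalMatrix, error, Matrix.vecHead, Matrix.vecTail, mul_comm]

theorem inner_gradient_tangent (φ : Fin 2 → E3 → ℝ) (i : Fin 2) (ξ : E3) :
    inner ℝ (gradient (φ i) ξ) (tangent φ ξ) = 0 := by
  rw [inner_eq_sum_three]
  fin_cases i <;> simp [tangent, cross_apply] <;> ring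

theorem inner_normalTerm_tangent (φ : Fin 2 → E3 → ℝ) (k : Fin 2 → ℝ) (ξ : E3) :
    inner ℝ (normalTerm φ k ξ) (tangent φ ξ) = 0 := by
  rw [normalTerm_eq, inner_add_left, inner_smul_left, inner_smul_left, inner_gradient_tangent,
    inner_gradient_tangent]
  simp

/-- Lower bound for the norm of a combination of two vectors of `ℝ³` by their cross product. -/
theorem cross_sq_mul_le (φ : Fin 2 → E3 → ℝ) (ξ : E3) (a b : ℝ) :
    ‖tangent φ ξ‖ ^ 2 * (a ^ 2 + b ^ 2) ≤
      (‖gradient (φ 0) ξ‖ ^ 2 + ‖gradient (φ 1) ξ‖ ^ 2) *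
        ‖a • gradient (φ 0) ξ + b • gradient (φ 1) ξ‖ ^ 2 := by
  simp only [norm_sq_eq_sum_three, tangent, cross_apply, PiLp.add_apply, PiLp.smul_apply,
    smul_eq_mul, Matrix.cons_val_zero, Matrix.cons_val_one, Matrix.cons_val]
  generalize gradient (φ 0) ξ = x
  generalize gradient (φ 1) ξ = y
  -- For w = ax + by one has w × y = a(x × y) and w × x = -b(x × y). By Lagrange's identity the two
  -- sides differ by exactly ⟨w, y⟩² + ⟨w, x⟩².
  have h1 := sq_nonneg ((a * x 0 + b * y 0) * y 0 + (a * x 1 + b * y 1) * y 1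
    + (a * x 2 + b * y 2) * y 2)
  have h2 := sq_nonneg ((a * x 0 + b * y 0) * x 0 + (a * x 1 + b * y 1) * x 1
    + (a * x 2 + b * y 2) * x 2)
  linear_combination h1 + h2

theorem contDiff_gradient {f : E3 → ℝ} (hf : ContDiff ℝ 2 f) :
    ContDiff ℝ 1 fun ξ => gradient f ξ :=
  (InnerProductSpace.toDual ℝ E3).symm.contDiff.comp (hf.fderiv_right (m := 1) (by norm_num))

theorem contDiff_tangent (hφ : ∀ i, ContDiff ℝ 2 (φ i)) : ContDiff ℝ 1 (tangent φ) := by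
  have h : ∀ i j, ContDiff ℝ 1 fun ξ => gradient (φ i) ξ j := fun i =>
    contDiff_euclidean.1 (contDiff_gradient (hφ i))
  refine contDiff_euclidean.2 fun j => ?_
  fin_cases j <;> simp only [tangent, cross_apply] <;> simp <;>
    exact ((h _ _).mul (h _ _)).sub ((h _ _).mul (h _ _))

theorem contDiff_normalTerm (hφ : ∀ i, ContDiff ℝ 2 (φ i)) (k : Fin 2 → ℝ) :
    ContDiff ℝ 1 (normalTerm φ k) := by
  have h : ∀ i, ContDiff ℝ 1 (φ i) := fun i => (hφ i).of_le one_le_two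
  rw [funext (normalTerm_eq φ k)]
  exact ((contDiff_const.mul (h 0)).smul (contDiff_gradient (hφ 0))).add
    ((contDiff_const.mul (h 1)).smul (contDiff_gradient (hφ 1)))

theorem contDiff_vectorField (hφ : ∀ i, ContDiff ℝ 2 (φ i)) (k : Fin 2 → ℝ) :
    ContDiff ℝ 1 (vectorField φ k) :=
  (contDiff_tangent hφ).sub (contDiff_normalTerm hφ k)

/-- Chain rule along a curve, in terms of the gradient. -/
theorem hasDerivWithinAt_comp_inner_gradient {f : E3 → ℝ} (hf : Differentiable ℝ f)
    {ξ : ℝ → E3} {v : E3} {J : Set ℝ} {t : ℝ} (hξ : HasDerivWithinAt ξ v J t) :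
    HasDerivWithinAt (fun s => f (ξ s)) (inner ℝ (gradient f (ξ t)) v) J t := by
  have h := (hf (ξ t)).hasFDerivAt.comp_hasDerivWithinAt t hξ
  rwa [gradient, InnerProductSpace.toDual_symm_apply]

theorem solvesErrorDynamics_error (hφ : ∀ i, ContDiff ℝ 2 (φ i)) {d : ℝ → E3} {J : Set ℝ}
    {ξ : ℝ → E3} (hξ : IsPerturbedSolution φ k d J ξ) :
    SolvesErrorDynamics φ k d J ξ fun t => error φ (ξ t) := by
  have hdiff : ∀ i, Differentiable ℝ (φ i) := fun i => (hφ i).differentiable two_ne_zero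
  refine ⟨?_, fun t ht hd => ?_⟩
  · refine (PiLp.continuous_toLp 2 _).comp_continuousOn (continuousOn_pi.2 fun i => ?_)
    exact (hφ i).continuous.comp_continuousOn hξ.1
  · have h : HasDerivWithinAt (fun s i => φ i (ξ s))
        (Matrix.mulVec (Matrix.transpose (normalMatrix φ (ξ t)))
          (vectorField φ k (ξ t) + d t).ofLp) J t := by
      refine hasDerivWithinAt_pi.2 fun i => ?_
      refine (hasDerivWithinAt_comp_inner_gradient (hdiff i) (hξ.2 t ht hd)).congr_deriv ?_
      rw [inner_eq_sum_three]
      simp [Matrix.mulVec, dotProduct, Fin.sum_univ_three, normalMatrix]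
    exact (PiLp.hasFDerivAt_toLp 2 _).comp_hasDerivWithinAt t h

/-! ### The energy and its dissipation near the path. -/

/-- The Lyapunov function `eᵀ K e` of the path-following error. -/
def errorEnergy (φ : Fin 2 → E3 → ℝ) (k : Fin 2 → ℝ) (ξ : E3) : ℝ :=
  k 0 * φ 0 ξ ^ 2 + k 1 * φ 1 ξ ^ 2

theorem continuous_errorEnergy (hφ : ∀ i, ContDiff ℝ 2 (φ i)) (k : Fin 2 → ℝ) :
    Continuous (errorEnergy φ k) :=
  (continuous_const.mul ((hφ 0).continuous.pow 2)).add
    (continuous_const.mul ((hφ 1).continuous.pow 2))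

theorem errorEnergy_le (φ : Fin 2 → E3 → ℝ) (k : Fin 2 → ℝ) (ξ : E3) :
    errorEnergy φ k ξ ≤ max (k 0) (k 1) * ‖error φ ξ‖ ^ 2 := by
  rw [norm_error_sq, errorEnergy, mul_add]
  gcongr
  exacts [le_max_left _ _, le_max_right _ _]

theorem le_errorEnergy (φ : Fin 2 → E3 → ℝ) (k : Fin 2 → ℝ) (ξ : E3) :
    min (k 0) (k 1) * ‖error φ ξ‖ ^ 2 ≤ errorEnergy φ k ξ := by
  rw [norm_error_sq, errorEnergy, mul_add]
  gcongr
  exacts [min_le_left _ _, min_le_right _ _]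

/-- Dissipation inequality for the Lyapunov function along a perturbed trajectory. -/
theorem exists_hasDerivAt_errorEnergy_le (hφ : ∀ i, ContDiff ℝ 2 (φ i)) {ξ : ℝ → E3} {t : ℝ}
    {δ : E3} (hξ : HasDerivAt ξ (vectorField φ k (ξ t) + δ) t) {a D : ℝ} (hδ : ‖δ‖ ≤ D)
    (ha : a * errorEnergy φ k (ξ t) ≤ ‖normalTerm φ k (ξ t)‖ ^ 2) :
    ∃ v', HasDerivAt (fun s => errorEnergy φ k (ξ s)) v' t ∧
      v' ≤ -a * errorEnergy φ k (ξ t) + D ^ 2 := by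
  have hg : ∀ i, HasDerivAt (fun s => φ i (ξ s))
      (inner ℝ (gradient (φ i) (ξ t)) (vectorField φ k (ξ t) + δ)) t := fun i => by
    rw [← hasDerivWithinAt_univ]
    exact hasDerivWithinAt_comp_inner_gradient ((hφ i).differentiable two_ne_zero)
      hξ.hasDerivWithinAt
  refine ⟨_, (((hg 0).pow 2).const_mul (k 0)).add (((hg 1).pow 2).const_mul (k 1)), ?_⟩
  set w := normalTerm φ k (ξ t) with hw
  have h1 : inner ℝ w (vectorField φ k (ξ t) + δ) = -‖w‖ ^ 2 + inner ℝ w δ := by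
    rw [vectorField, inner_add_right, inner_sub_right, hw, inner_normalTerm_tangent,
      real_inner_self_eq_norm_sq]
    ring
  have h2 : inner ℝ w (vectorField φ k (ξ t) + δ)
      = k 0 * φ 0 (ξ t) * inner ℝ (gradient (φ 0) (ξ t)) (vectorField φ k (ξ t) + δ)
        + k 1 * φ 1 (ξ t) * inner ℝ (gradient (φ 1) (ξ t)) (vectorField φ k (ξ t) + δ) := by
    rw [hw, normalTerm_eq, inner_add_left, real_inner_smul_left, real_inner_smul_left]
  have h3 := real_inner_le_norm w δ
  have h4 : ‖δ‖ ^ 2 ≤ D ^ 2 := by gcongr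
  -- Young's inequality 2‖w‖‖δ‖ ≤ ‖w‖² + ‖δ‖² spends one of the two copies of -‖w‖² and leaves the
  -- other for the decay.
  have h5 := sq_nonneg (‖w‖ - ‖δ‖)
  simp only [Nat.cast_ofNat, Nat.add_one_sub_one, pow_one]
  linarith

/-- The tangential term does not vanish on the path. -/
theorem tangent_ne_zero_of_mem_desiredPath
    (hC : 0 < setDist (desiredPath φ) (singularSet φ k)) {ξ : E3} (hξ : ξ ∈ desiredPath φ) :
    tangent φ ξ ≠ 0 := by
  intro h
  refine hC.ne' (le_antisymm ?_ bot_le)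
  have hs : ξ ∈ singularSet φ k := by
    change tangent φ ξ - normalTerm φ k ξ = 0
    rw [h, normalTerm_eq, hξ 0, hξ 1]
    simp
  exact (iInf₂_le_of_le ξ hξ (iInf₂_le_of_le ξ hs (edist_self ξ).le))

theorem isCompact_desiredPath (hφ : ∀ i, ContDiff ℝ 2 (φ i))
    (hP : Bornology.IsBounded (desiredPath φ)) : IsCompact (desiredPath φ) := by
  refine Metric.isCompact_of_isClosed_isBounded ?_ hP
  have : desiredPath φ = ⋂ i, φ i ⁻¹' {0} := by ext; simp [desiredPath]
  rw [this]
  exact isClosed_iInter fun i => isClosed_singleton.preimage (hφ i).continuous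

/-- The infimum may be infinite, so a finite number strictly between 0 and it serves as threshold.
-/
theorem ErrorControlsDistance.exists_pos (hE : ErrorControlsDistance φ) {κ : ℝ} (hκ : 0 < κ) :
    ∃ m : ℝ, 0 < m ∧ ∀ ξ, ‖error φ ξ‖ < m → Metric.infDist ξ (desiredPath φ) < κ := by
  obtain ⟨m, hm, hm'⟩ := ENNReal.lt_iff_exists_nnreal_btwn.1 (hE κ hκ)
  refine ⟨m, by simpa using hm, fun ξ hξ => ?_⟩
  by_contra! h
  have h1 := hm'.le.trans (iInf₂_le ξ h)
  rw [← ENNReal.ofReal_coe_nnreal, ENNReal.ofReal_le_ofReal_iff (norm_nonneg _)] at h1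
  linarith

/-- On a neighbourhood of the path, described by a bound on the error, points remain in a fixed
ball and the dissipation `‖N K e‖²` dominates the Lyapunov function. -/
theorem exists_dissipation_bound (hφ : ∀ i, ContDiff ℝ 2 (φ i)) (hk : ∀ i, 0 < k i)
    (hne : (desiredPath φ).Nonempty) (hP : Bornology.IsBounded (desiredPath φ))
    (hC : 0 < setDist (desiredPath φ) (singularSet φ k)) (hE : ErrorControlsDistance φ) :
    ∃ a m R : ℝ, 0 < a ∧ 0 < m ∧ 0 < R ∧ ∀ ξ, ‖error φ ξ‖ < m →
      ‖ξ‖ ≤ R ∧ a * errorEnergy φ k ξ ≤ ‖normalTerm φ k ξ‖ ^ 2 := by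
  have hcpt := isCompact_desiredPath hφ hP
  have hτ := (contDiff_tangent hφ).continuous
  obtain ⟨κ, hκ, hU⟩ := hcpt.exists_cthickening_subset_open (isOpen_ne_fun hτ continuous_const)
    fun ξ hξ => tangent_ne_zero_of_mem_desiredPath hC hξ
  obtain ⟨m, hm, hm'⟩ := hE.exists_pos hκ
  set U := Metric.cthickening κ (desiredPath φ)
  have hUc : IsCompact U := hcpt.cthickening
  have hUne : U.Nonempty := hne.mono (Metric.self_subset_cthickening _)
  obtain ⟨ξ₁, hξ₁, hmin⟩ := hUc.exists_isMinOn hUne (hτ.norm.pow 2).continuousOn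
  obtain ⟨ξ₂, hξ₂, hmax⟩ := hUc.exists_isMaxOn hUne
    ((((contDiff_gradient (hφ 0)).continuous.norm.pow 2).add
      ((contDiff_gradient (hφ 1)).continuous.norm.pow 2)).continuousOn)
  obtain ⟨R, hR, hR'⟩ := hUc.isBounded.exists_pos_norm_le
  set μ := ‖tangent φ ξ₁‖ ^ 2
  set B := ‖gradient (φ 0) ξ₂‖ ^ 2 + ‖gradient (φ 1) ξ₂‖ ^ 2
  have hμ : 0 < μ := pow_pos (norm_pos_iff.2 (hU hξ₁)) 2
  have hB : 0 < B + 1 := by positivity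
  have hkm : 0 < min (k 0) (k 1) := lt_min (hk 0) (hk 1)
  -- The ratio of μ to B + 1 comes from `cross_sq_mul_le`, and min k from ‖Ke‖² ≥ (min k) V. Using B
  -- + 1 avoids checking B ≠ 0.
  refine ⟨μ * min (k 0) (k 1) / (B + 1), m, R, by positivity, hm, hR, fun ξ hξ => ?_⟩
  have hξU : ξ ∈ U := Metric.thickening_subset_cthickening _ _ <| by
    obtain ⟨y, hy, hy'⟩ := (Metric.infDist_lt_iff hne).1 (hm' ξ hξ)
    exact Metric.mem_thickening_iff.2 ⟨y, hy, hy'⟩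
  refine ⟨hR' ξ hξU, ?_⟩
  have h1 := cross_sq_mul_le φ ξ (k 0 * φ 0 ξ) (k 1 * φ 1 ξ)
  rw [← normalTerm_eq] at h1
  have h2 : μ ≤ ‖tangent φ ξ‖ ^ 2 := hmin hξU
  have h3 : ‖gradient (φ 0) ξ‖ ^ 2 + ‖gradient (φ 1) ξ‖ ^ 2 ≤ B := hmax hξU
  have h4 : min (k 0) (k 1) * errorEnergy φ k ξ ≤ (k 0 * φ 0 ξ) ^ 2 + (k 1 * φ 1 ξ) ^ 2 := by
    have e0 : (k 0 * φ 0 ξ) ^ 2 = k 0 * (k 0 * φ 0 ξ ^ 2) := by ring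
    have e1 : (k 1 * φ 1 ξ) ^ 2 = k 1 * (k 1 * φ 1 ξ ^ 2) := by ring
    have := (hk 0).le
    have := (hk 1).le
    rw [errorEnergy, mul_add, e0, e1]
    gcongr
    exacts [min_le_left _ _, min_le_right _ _]
  rw [div_mul_eq_mul_div, div_le_iff₀ hB]
  calc μ * min (k 0) (k 1) * errorEnergy φ k ξ
      = μ * (min (k 0) (k 1) * errorEnergy φ k ξ) := by ring
    _ ≤ ‖tangent φ ξ‖ ^ 2 * ((k 0 * φ 0 ξ) ^ 2 + (k 1 * φ 1 ξ) ^ 2) := by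
        refine (mul_le_mul_of_nonneg_left h4 hμ.le).trans ?_
        gcongr
    _ ≤ _ := h1
    _ ≤ ‖normalTerm φ k ξ‖ ^ 2 * (B + 1) := by
        rw [mul_comm]
        exact mul_le_mul_of_nonneg_left (by linarith) (sq_nonneg _)

/-! ### Trajectories of the perturbed system. -/

/-- Trajectories of a field that agrees with the guiding vector field on a dissipative sublevel
set of the Lyapunov function stay there, and the Lyapunov function decays up to the
disturbance. -/
theorem errorEnergy_trajectory (hφ : ∀ i, ContDiff ℝ 2 (φ i)) {F : E3 → E3} {a v₀ D₀ T : ℝ}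
    (ha : 0 < a) (hF : ∀ x, errorEnergy φ k x < v₀ → F x = vectorField φ k x)
    (hdiss : ∀ x, errorEnergy φ k x < v₀ →
      a * errorEnergy φ k x ≤ ‖normalTerm φ k x‖ ^ 2)
    {d : ℝ → E3} (hd : PiecewiseContinuous d) (hD₀ : ∀ s, 0 ≤ s → ‖d s‖ ≤ D₀)
    (hD₀v : D₀ ^ 2 / a ≤ v₀) {ξ : ℝ → E3} (hξ : ContinuousOn ξ (Ico 0 T))
    (hξ' : ∀ t ∈ Ioo 0 T, ContinuousWithinAt d (Ici 0) t → HasDerivAt ξ (F (ξ t) + d t) t)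
    (h0 : errorEnergy φ k (ξ 0) < v₀) :
    ∀ t ∈ Ico 0 T, errorEnergy φ k (ξ t) < v₀ ∧
      ∀ D, (∀ s ∈ Icc 0 t, ‖d s‖ ≤ D) →
        errorEnergy φ k (ξ t) ≤ Real.exp (-a * t) * errorEnergy φ k (ξ 0)
          + (1 - Real.exp (-a * t)) * (D ^ 2 / a) := by
  have hcont : ContinuousOn (fun s => errorEnergy φ k (ξ s)) (Ico 0 T) :=
    (continuous_errorEnergy hφ k).comp_continuousOn hξ
  have hderiv : ∀ t, ∀ s ∈ Ioo 0 t, t < T → s ∉ (hd.1 t).toFinset →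
      errorEnergy φ k (ξ s) < v₀ → ∀ D, ‖d s‖ ≤ D →
      ∃ v', HasDerivAt (fun s => errorEnergy φ k (ξ s)) v' s ∧
        v' ≤ -a * errorEnergy φ k (ξ s) + D ^ 2 := by
    intro t s hs ht hsS hv D hD
    have hcs : ContinuousWithinAt d (Ici 0) s := by
      by_contra h
      exact hsS ((hd.1 t).mem_toFinset.2 ⟨Ioo_subset_Icc_self hs, h⟩)
    have h := hξ' s ⟨hs.1, hs.2.trans ht⟩ hcs
    rw [hF _ hv] at h
    exact exists_hasDerivAt_errorEnergy_le hφ h hD (hdiss _ hv)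
  have hlt := lt_of_deriv_le_off_finite ha hD₀v h0 (fun t => (hd.1 t).toFinset) hcont
    fun t s hs ht hsS hv => hderiv t s hs ht hsS hv D₀ (hD₀ s hs.1.le)
  intro t ht
  refine ⟨hlt t ht, fun D hD => ?_⟩
  -- Invariance used the global bound D₀; the inequality is now integrated with a bound on [0, t]
  -- alone, so only the past of d enters.
  exact le_exp_of_deriv_le_off_finite ha ht.1 (hd.1 t).toFinset
    (hcont.mono (Icc_subset_Ico_right ht.2)) fun s hs hsS =>
    hderiv t s hs ht.2 hsS (hlt s ⟨hs.1.le, hs.2.trans ht.2⟩) D (hD s (Ioo_subset_Icc_self hs))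

/-- The disturbed equation with a compactly supported `C¹` field has global solutions. -/
theorem exists_solution_of_hasCompactSupport {F : E3 → E3} (hF : ContDiff ℝ 1 F)
    (hFc : HasCompactSupport F) {d : ℝ → E3} (hd : IsDisturbance d) (ξ₀ : E3) :
    ∃ ξ : ℝ → E3, ξ 0 = ξ₀ ∧ Continuous ξ ∧
      ∀ t, 0 ≤ t → ContinuousWithinAt d (Ici 0) t →
        HasDerivWithinAt ξ (F (ξ t) + d t) (Ici 0) t ∧
        (0 < t → HasDerivAt ξ (F (ξ t) + d t) t) := by
  obtain ⟨K, hK⟩ := hF.lipschitzWith_of_hasCompactSupport hFc one_ne_zero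
  obtain ⟨L, hL⟩ := hFc.exists_bound_of_continuous hF.continuous
  obtain ⟨M, hM⟩ := hd.2
  -- Freezing d at d 0 for negative times turns one-sided continuity at 0 into two-sided continuity.
  have hmax : Continuous fun t : ℝ => max t 0 := continuous_id.max continuous_const
  have hdc : ∀ t, 0 ≤ t → ContinuousWithinAt d (Ici 0) t →
      ContinuousAt (fun t => d (max t 0)) t := by
    intro t ht h
    rw [← continuousWithinAt_univ]
    refine ContinuousWithinAt.comp (t := Ici 0) ?_ hmax.continuousWithinAt
      fun s _ => le_max_right s 0
    rwa [max_eq_left ht]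
  have hcount : {t | ¬ ContinuousAt (fun t => d (max t 0)) t}.Countable := by
    refine (countable_iUnion fun n : ℕ => (hd.1.1 n).countable).mono fun t ht => ?_
    have ht0 : 0 ≤ t := by
      by_contra! h
      refine ht (continuousAt_const.congr (f := fun _ => d 0) ?_)
      filter_upwards [Iio_mem_nhds h] with s hs
      rw [max_eq_right (le_of_lt hs)]
    obtain ⟨n, hn⟩ := exists_nat_ge t
    exact mem_iUnion.2 ⟨n, ⟨ht0, hn⟩, fun h => ht (hdc t ht0 h)⟩
  obtain ⟨D, hD0, hDc, hD⟩ := exists_primitive_off_finite (d := fun t => d (max t 0))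
    (fun t => hM ⟨max t 0, le_max_right t 0, rfl⟩) hcount
  -- The substitution ξ = η + D removes the jumps: η' = F(η + D(t)) is continuous in time.
  obtain ⟨η, hη0, hη⟩ := exists_global_solution (f := fun t x => F (x + D t)) (K := K)
    (L := L.toNNReal)
    (fun t => LipschitzWith.of_dist_le_mul fun x y => by
      simpa using hK.dist_le_mul (x + D t) (y + D t))
    (fun x => hF.continuous.comp (continuous_const.add hDc))
    (fun t x => (hL _).trans (Real.le_coe_toNNReal L)) ξ₀
  refine ⟨fun t => η t + D t, by simp [hη0, hD0],
    (continuous_iff_continuousAt.2 fun t => (hη t).continuousAt).add hDc, fun t ht hct => ?_⟩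
  have h := (hη t).add (hD t (hdc t ht hct))
  rw [max_eq_left ht] at h
  exact ⟨h.hasDerivWithinAt, fun _ => h⟩

/-! ### Comparison functions and the final estimate. -/

theorem isClassKL_mul_exp {C b : ℝ} (hC : 0 < C) (hb : 0 < b) :
    IsClassKL fun ρ t => C * ρ * Real.exp (-b * t) := by
  refine ⟨by fun_prop, fun s _ => ⟨by fun_prop, ?_, by simp⟩, fun ρ hρ => ⟨?_, ?_⟩⟩
  · intro x _ y _ hxy
    have := Real.exp_pos (-b * s)
    simp only
    gcongr
  · intro x _ y _ hxy
    simp only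
    refine mul_le_mul_of_nonneg_left (Real.exp_le_exp.2 ?_) (mul_nonneg hC.le hρ)
    nlinarith
  · have h : Tendsto (fun t : ℝ => Real.exp (-b * t)) atTop (𝓝 0) :=
      Real.tendsto_exp_atBot.comp (tendsto_id.const_mul_atTop_of_neg (neg_lt_zero.2 hb))
    simpa using h.const_mul (C * ρ)

theorem isClassK_const_mul {G : ℝ} (hG : 0 < G) : IsClassK fun x => G * x :=
  ⟨by fun_prop, fun _ _ _ _ h => mul_lt_mul_of_pos_left h hG, mul_zero G⟩

/-- Square root form of a decay estimate for the Lyapunov function. -/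
theorem norm_le_of_sq_le {x ρ D p q a t : ℝ} (hρ : 0 ≤ ρ) (hD : 0 ≤ D) (hp : 0 < p) (hq : 0 < q)
    (ha : 0 < a)
    (h : p * x ^ 2 ≤ Real.exp (-a * t) * (q * ρ ^ 2) + D ^ 2 / a) :
    x ≤ √(q / p) * ρ * Real.exp (-(a / 2) * t) + (√(a * p))⁻¹ * D := by
  have hexp : Real.exp (-a * t) = Real.exp (-(a / 2) * t) ^ 2 := by
    rw [← Real.exp_nat_mul]
    congr 1
    push_cast
    ring
  set E := Real.exp (-(a / 2) * t)
  have hE : 0 < E := Real.exp_pos _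
  have h1 : √(q / p) ^ 2 = q / p := Real.sq_sqrt (by positivity)
  have h2 : (√(a * p))⁻¹ ^ 2 = (a * p)⁻¹ := by rw [inv_pow, Real.sq_sqrt (by positivity)]
  refine le_of_sq_le_sq ?_ (by positivity)
  have h3 : x ^ 2 ≤ q / p * ρ ^ 2 * E ^ 2 + (a * p)⁻¹ * D ^ 2 := by
    have : q / p * ρ ^ 2 * E ^ 2 + (a * p)⁻¹ * D ^ 2
        = (Real.exp (-a * t) * (q * ρ ^ 2) + D ^ 2 / a) / p := by
      rw [hexp]
      field_simp
    rw [this, le_div_iff₀ hp]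
    linarith
  -- With a nonnegative cross term, the sum of the squares is at most the square of the sum.
  have h4 : 0 ≤ (√(q / p) * ρ * E) * ((√(a * p))⁻¹ * D) := by positivity
  calc x ^ 2 ≤ √(q / p) ^ 2 * ρ ^ 2 * E ^ 2 + (√(a * p))⁻¹ ^ 2 * D ^ 2 := by rwa [h1, h2]
    _ ≤ _ := by nlinarith

theorem errorLocallyISS (hφ : ∀ i, ContDiff ℝ 2 (φ i)) (hk : ∀ i, 0 < k i)
    (hne : (desiredPath φ).Nonempty) (hP : Bornology.IsBounded (desiredPath φ))
    (hC : 0 < setDist (desiredPath φ) (singularSet φ k)) (hE : ErrorControlsDistance φ) :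
    ErrorLocallyISS φ k := by
  obtain ⟨a, m, R, ha, hm, hR, hdiss⟩ := exists_dissipation_bound hφ hk hne hP hC hE
  set p := min (k 0) (k 1)
  set q := max (k 0) (k 1)
  have hp : 0 < p := lt_min (hk 0) (hk 1)
  have hq : 0 < q := lt_max_of_lt_left (hk 0)
  have hsub : ∀ x, errorEnergy φ k x < p * m ^ 2 → ‖error φ x‖ < m := fun x hx =>
    lt_of_pow_lt_pow_left₀ 2 hm.le
      (lt_of_mul_lt_mul_left ((le_errorEnergy φ k x).trans_lt hx) hp.le)
  -- From p‖e‖² ≤ V ≤ q‖e‖²: c gives V(ξ₀) < p m², r gives D₀² / a ≤ p m², and V < p m² implies ‖e‖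
  -- < m.
  refine ⟨fun ρ t => √(q / p) * ρ * Real.exp (-(a / 2) * t), fun x => (√(a * p))⁻¹ * x,
    m * √(p / q), √(a * (p * m ^ 2)), isClassKL_mul_exp (by positivity) (by positivity),
    isClassK_const_mul (by positivity), by positivity, by positivity, fun ξ₀ d hξ₀ hd hdr => ?_⟩
  set D₀ := sSup ((fun s => ‖d s‖) '' Ici 0)
  have hD₀ : ∀ s, 0 ≤ s → ‖d s‖ ≤ D₀ := fun s hs => le_csSup hd.2 ⟨s, hs, rfl⟩
  have hD₀v : D₀ ^ 2 / a ≤ p * m ^ 2 := by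
    rw [div_le_iff₀ ha, mul_comm (p * m ^ 2)]
    exact ((Real.lt_sqrt ((norm_nonneg _).trans (hD₀ 0 le_rfl))).1 hdr).le
  have hV₀ : errorEnergy φ k ξ₀ < p * m ^ 2 := by
    refine (errorEnergy_le φ k ξ₀).trans_lt ?_
    have h : ‖error φ ξ₀‖ ^ 2 < (m * √(p / q)) ^ 2 := by gcongr
    rw [mul_pow, Real.sq_sqrt (by positivity)] at h
    calc q * ‖error φ ξ₀‖ ^ 2 < q * (m ^ 2 * (p / q)) := by gcongr
      _ = p * m ^ 2 := by field_simp
  constructor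
  -- The bump equals 1 on the ball of radius R, which contains the invariant sublevel set.
  · let ψ : ContDiffBump (0 : E3) := ⟨R, R + 1, hR, by linarith⟩
    obtain ⟨ξ, h0, hξc, hξ⟩ := exists_solution_of_hasCompactSupport
      (F := fun x => ψ x • vectorField φ k x)
      (ψ.contDiff.smul (contDiff_vectorField hφ k)) ψ.hasCompactSupport.smul_right hd ξ₀
    have hF : ∀ x, errorEnergy φ k x < p * m ^ 2 →
        ψ x • vectorField φ k x = vectorField φ k x := fun x hx => by
      rw [ψ.one_of_mem_closedBall (mem_closedBall_zero_iff.2 (hdiss x (hsub x hx)).1), one_smul]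
    refine ⟨ξ, ⟨hξc.continuousOn, fun t ht hct => ?_⟩, h0⟩
    have h := (errorEnergy_trajectory hφ ha hF (fun x hx => (hdiss x (hsub x hx)).2) hd.1 hD₀
      hD₀v (T := t + 1) hξc.continuousOn
      (fun s hs hcs => (hξ s hs.1.le hcs).2 hs.1) (by rwa [h0]) t ⟨ht, lt_add_one t⟩).1
    rw [← hF _ h]
    exact (hξ t ht hct).1
  -- The estimate applies to the untruncated field directly, so no uniqueness of solutions is
  -- needed.
  · rintro T ξ hξ rfl t ht
    have h := (errorEnergy_trajectory hφ ha (fun _ _ => rfl)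
      (fun x hx => (hdiss x (hsub x hx)).2) hd.1 hD₀ hD₀v hξ.1
      (fun s hs hcs => (hξ.2 s (Ioo_subset_Ico_self hs) hcs).hasDerivAt
        (Ico_mem_nhds hs.1 hs.2)) hV₀ t ht).2
    set D := sSup ((fun s => ‖d s‖) '' Icc 0 t)
    have hD : ∀ s ∈ Icc 0 t, ‖d s‖ ≤ D := fun s hs =>
      le_csSup (hd.2.mono (image_mono Icc_subset_Ici_self)) ⟨s, hs, rfl⟩
    refine norm_le_of_sq_le (norm_nonneg _)
      ((norm_nonneg _).trans (hD t (right_mem_Icc.2 ht.1))) hp hq ha ?_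
    refine (le_errorEnergy φ k (ξ t)).trans ((h D hD).trans (add_le_add ?_ ?_))
    · exact mul_le_mul_of_nonneg_left (errorEnergy_le φ k (ξ 0)) (Real.exp_pos _).le
    · exact mul_le_of_le_one_left (by positivity) (by linarith [Real.exp_pos (-a * t)])

end PathFollowing

theorem mainTheorem3
    (φ : Fin 2 → PathFollowing.E3 → ℝ) (k : Fin 2 → ℝ)
    (hφ : ∀ i, ContDiff ℝ 2 (φ i))
    (hk : ∀ i, 0 < k i)
    (hP_nonempty : (PathFollowing.desiredPath φ).Nonempty)
    (hP_bounded : Bornology.IsBounded (PathFollowing.desiredPath φ))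
    (hC : 0 < PathFollowing.setDist (PathFollowing.desiredPath φ)
      (PathFollowing.singularSet φ k))
    (hE : PathFollowing.ErrorControlsDistance φ)
    (hC' : 0 < PathFollowing.setDist (PathFollowing.desiredPath φ)
      (PathFollowing.degenerateSet φ k)) :
    (∀ (d : ℝ → PathFollowing.E3) (T : ℝ) (ξ : ℝ → PathFollowing.E3),
      PathFollowing.IsDisturbance d →
      PathFollowing.IsPerturbedSolution φ k d (Set.Ico 0 T) ξ →
      PathFollowing.SolvesErrorDynamics φ k d (Set.Ico 0 T) ξ
        (fun t => PathFollowing.error φ (ξ t))) ∧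
    PathFollowing.ErrorLocallyISS φ k :=
  ⟨fun _ _ _ _ hξ => PathFollowing.solvesErrorDynamics_error hφ hξ,
    PathFollowing.errorLocallyISS hφ hk hP_nonempty hP_bounded hC hE⟩
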